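/- Let $G$ be a finite group operating (from the right, not necessarily faithfully, $y\mapsto y^\sigma$) by ring automorphisms on a field $L$, with fixed field $K=\mathrm{Fix}_G L$. Let $S$ be a discrete valuation ring with field of fractions $K$, maximal ideal $\pi S$ and finite residue field $\bar S=S/\pi S$ of characteristic $p$. Let $T$ be the integral closure of $S$ in $L$, and put $\bar T=T/\pi T$ and $\bar T_0=T/\mathrm{Jac}(T)$, where $\mathrm{Jac}$ denotes the Jacobson radical; $G$ operates on $T$, $\bar T$ and $\bar T_0$. For a commutative ring $C$ on which $G$ operates, the twisted group ring $C\wr G$ is the free right $C$-module with basis $G$ and multiplication determined by $(\sigma y)(\tau z)=\sigma\tau\, y^\tau z$ for $\sigma,\tau\in G$, $y,z\in C$. Let $\Lambda=T\wr G$ and $\bar\Lambda=\bar T\wr G$. For $\sigma\in G$ let $$V_\sigma=\big\langle\, (y^\sigma-y)z,\ y^\rho-y \ \big|\ y,z\in\bar T_0,\ \rho\in C_G(\sigma)\,\big\rangle_{\bar S}\subseteq\bar T_0 ,$$ the $\bar S$-linear span, where $C_G(\sigma)$ is the centralizer of $\sigma$ in $G$. Let $\mathcal C$ be a system of representatives of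 the conjugacy classes of those elements of $G$ whose order is not divisible by $p$. Theorem. We have $$\dim_{\bar S} Z(\Lambda/\mathrm{Jac}(\Lambda))\;=\;\dim_{\bar S} Z(\bar\Lambda/\mathrm{Jac}(\bar\Lambda))\;=\;\sum_{\sigma\in\mathcal C}\dim_{\bar S}(\bar T_0/V_\sigma),$$ where $Z$ denotes the center. -/

import Mathlib

noncomputable section

namespace TwistedGroupRing

section QuotientAction

variable {G R : Type*} [Group G] [CommRing R] [MulSemiringAction G R]

/-- The operation of `G` on `R ⧸ I` induced by an operation of `G` on `R` by ring automorphisms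
that maps the ideal `I` into itself. -/
@[reducible]
def quotientAction (I : Ideal R) (hI : ∀ (g : G), ∀ x ∈ I, g • x ∈ I) :
    MulSemiringAction G (R ⧸ I) :=
  let φ : G → R ⧸ I →+* R ⧸ I := fun g =>
    Ideal.quotientMap I (MulSemiringAction.toRingHom G R g) (fun x hx => hI g x hx)
  { smul := fun g x => φ g x
    one_smul := by
      intro x
      obtain ⟨x, rfl⟩ := Ideal.Quotient.mk_surjective x
      exact congrArg (Ideal.Quotient.mk I) (one_smul G x)
    mul_smul := by
      intro g h x
      obtain ⟨x, rfl⟩ := Ideal.Quotient.mk_surjective x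
      exact congrArg (Ideal.Quotient.mk I) (mul_smul g h x)
    smul_zero := fun g => map_zero (φ g)
    smul_add := fun g => map_add (φ g)
    smul_one := fun g => map_one (φ g)
    smul_mul := fun g => map_mul (φ g) }

theorem smul_mem_jacobson (g : G) (x : R) (hx : x ∈ Ring.jacobson R) :
    g • x ∈ Ring.jacobson R := by
  have : RingHomSurjective (MulSemiringAction.toRingEquiv G R g : R →+* R) :=
    ⟨(MulSemiringAction.toRingEquiv G R g).surjective⟩
  exact Ring.le_comap_jacobson (MulSemiringAction.toRingEquiv G R g : R →+* R) hx

/-- `G` operates on `R / Jac(R)`. -/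
instance jacobsonQuotientAction : MulSemiringAction G (R ⧸ Ring.jacobson R) :=
  quotientAction _ smul_mem_jacobson

variable {S : Type*} [CommRing S] [Algebra S R] [SMulCommClass G S R]

theorem smul_mem_map (I : Ideal S) (g : G) (x : R) (hx : x ∈ I.map (algebraMap S R)) :
    g • x ∈ I.map (algebraMap S R) := by
  have h : (I.map (algebraMap S R)).map (MulSemiringAction.toAlgHom S R g) ≤
      I.map (algebraMap S R) := by
    rw [← Ideal.map_coe, Ideal.map_map, AlgHom.comp_algebraMap]
  exact h (Ideal.mem_map_of_mem _ hx)

/-- If `G` operates `S`-linearly on `R` then it operates on `R / IR` for each ideal `I` of `S`. -/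
instance mapQuotientAction (I : Ideal S) :
    MulSemiringAction G (R ⧸ I.map (algebraMap S R)) :=
  quotientAction _ (smul_mem_map I)

instance mapQuotient_smulCommClass (I : Ideal S) :
    SMulCommClass G S (R ⧸ I.map (algebraMap S R)) where
  smul_comm g s x := by
    obtain ⟨x, rfl⟩ := Ideal.Quotient.mk_surjective x
    exact congrArg (Ideal.Quotient.mk _) (smul_comm g s x)

end QuotientAction

section SkewIntegral

variable {G R S : Type*} [Group G] [Finite G] [CommRing R] [MulSemiringAction G R]
  [CommRing S] [Algebra S R] [SMulCommClass G S R] [Algebra.IsIntegral S R]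

/-- The twisted group ring over an integral `S`-algebra is integral over `S`. -/
instance skew_isIntegral : Algebra.IsIntegral S (SkewMonoidAlgebra R G) where
  isIntegral x := by
    classical
    have := Fintype.ofFinite G
    let F : Set R := Set.range fun p : G × G => p.1 • x.coeff p.2
    let B : Subalgebra S R := Algebra.adjoin S F
    have hBfg : (Subalgebra.toSubmodule B).FG :=
      fg_adjoin_of_finite (Set.finite_range _) fun r _ => Algebra.IsIntegral.isIntegral r
    have hGB : ∀ (g : G) (b : R), b ∈ B → g • b ∈ B := by
      intro g b hb
      have h1 : B ≤ B.comap (MulSemiringAction.toAlgHom S R g) := by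
        refine Algebra.adjoin_le ?_
        rintro _ ⟨p, rfl⟩
        exact Algebra.subset_adjoin ⟨(g * p.1, p.2), mul_smul _ _ _⟩
      exact h1 hb
    let N₀ : Submodule S (SkewMonoidAlgebra R G) :=
      { carrier := {f | ∀ g, f.coeff g ∈ B}
        add_mem' := by
          intro f f' hf hf' g
          rw [SkewMonoidAlgebra.coeff_add, Finsupp.add_apply]
          exact B.add_mem (hf g) (hf' g)
        zero_mem' := fun g => B.zero_mem
        smul_mem' := by
          intro s f hf g
          rw [SkewMonoidAlgebra.coeff_smul, Finsupp.smul_apply]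
          exact B.smul_mem (hf g) s }
    have hsingle : ∀ (g : G) (b : R), b ∈ B → SkewMonoidAlgebra.single g b ∈ N₀ := by
      intro g b hb h
      rw [SkewMonoidAlgebra.coeff_single, Finsupp.single_apply]
      split_ifs
      · exact hb
      · exact B.zero_mem
    let N : Subalgebra S (SkewMonoidAlgebra R G) :=
      N₀.toSubalgebra (hsingle 1 1 B.one_mem) fun f f' hf hf' => by
        rw [SkewMonoidAlgebra.mul_def, SkewMonoidAlgebra.sum_def]
        refine N₀.sum_mem fun i _ => ?_
        beta_reduce
        rw [SkewMonoidAlgebra.sum_def]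
        exact N₀.sum_mem fun j _ => hsingle _ _ (B.mul_mem (hf i) (hGB i _ (hf' j)))
    refine IsIntegral.of_mem_of_fg N ?_ x fun g => Algebra.subset_adjoin ⟨(1, g), one_smul _ _⟩
    let e : SkewMonoidAlgebra R G ≃ₗ[S] (G → R) :=
      SkewMonoidAlgebra.coeffLinearEquiv.trans (Finsupp.linearEquivFunOnFinite S R G)
    have hpi : (Submodule.pi Set.univ fun _ : G => Subalgebra.toSubmodule B).FG :=
      Submodule.fg_pi fun _ => hBfg
    have hN : Subalgebra.toSubmodule N = (Submodule.pi Set.univ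
        fun _ : G => Subalgebra.toSubmodule B).map e.symm.toLinearMap := by
      refine Submodule.ext fun f => ?_
      rw [Submodule.mem_map_equiv]
      simp only [Submodule.mem_pi, Set.mem_univ, true_imp_iff]
      rfl
    rw [hN]
    exact hpi.map _

end SkewIntegral

section ResidueAlgebra

variable {S A : Type*} [CommRing S] [IsLocalRing S] [Ring A] [Algebra S A]
  [Algebra.IsIntegral S A]

theorem maximalIdeal_le_comap_jacobson :
    IsLocalRing.maximalIdeal S ≤ (Ring.jacobson A).comap (algebraMap S A) := by
  intro a ha
  rw [Ideal.mem_comap, Ring.jacobson_eq_sInf_isMaximal, Submodule.mem_sInf]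
  intro M hM
  by_contra haM
  have htop : M ⊔ Ideal.span {algebraMap S A a} = ⊤ := by
    refine hM.1.2 _ (lt_of_le_of_ne le_sup_left fun h => haM ?_)
    rw [h]
    exact Ideal.mem_sup_right (Ideal.mem_span_singleton_self _)
  obtain ⟨u, hu, v, hv, huv⟩ := Submodule.mem_sup.1 ((Ideal.eq_top_iff_one _).1 htop)
  obtain ⟨x, rfl⟩ := Ideal.mem_span_singleton'.1 hv
  let B := Algebra.adjoin S {x}
  have : IsMulCommutative B := Algebra.isMulCommutative_adjoin S (by simp)
  let x' : B := ⟨x, Algebra.subset_adjoin rfl⟩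
  have : Algebra.IsIntegral S B :=
    ⟨fun b => (isIntegral_algHom_iff B.val Subtype.val_injective).1
      (Algebra.IsIntegral.isIntegral (b : A))⟩
  have hunit : IsUnit (1 - x' * algebraMap S B a) := by
    by_contra hn
    obtain ⟨P, hP, hmem⟩ := exists_max_ideal_of_mem_nonunits hn
    have hc := Ideal.isMaximal_comap_of_isIntegral_of_isMaximal (R := S) P
    have haP : algebraMap S B a ∈ P := by
      rw [← Ideal.mem_comap, IsLocalRing.eq_maximalIdeal hc]
      exact ha
    refine hP.ne_top ((Ideal.eq_top_iff_one P).2 ?_)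
    have := P.add_mem hmem (P.mul_mem_left x' haP)
    simpa using this
  have hval : u = B.val (1 - x' * algebraMap S B a) := by
    rw [eq_sub_of_add_eq huv]
    rfl
  obtain ⟨w, hw⟩ := hunit.exists_left_inv
  refine hM.ne_top ((Ideal.eq_top_iff_one M).2 ?_)
  have h1 : B.val w * u = 1 := by
    rw [hval]
    exact congrArg B.val hw
  rw [← h1]
  exact M.smul_mem _ hu

/-- `A / Jac(A)` is an algebra over the residue field of the local ring `S`, for each integral
`S`-algebra `A`. -/
instance residueAlgebra : Algebra (IsLocalRing.ResidueField S) (A ⧸ Ring.jacobson A) :=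
  Ideal.Quotient.algebraQuotientOfLEComap maximalIdeal_le_comap_jacobson

end ResidueAlgebra

section RightNotation

variable {G R : Type*} [Group G] [CommRing R] [MulSemiringAction G R]

/-- The element `σ y` of the twisted group ring `R ≀ G`. A left operation of `G` on `R` is the same
as a right operation, by `y ^ σ = σ⁻¹ • y`. As `σ y = y ^ (σ⁻¹) σ`, its coefficient with respect to
the left `R`-basis `G` of the Mathlib ring `SkewMonoidAlgebra R G` is `σ • y`. -/
def of (σ : G) (y : R) : SkewMonoidAlgebra R G :=
  SkewMonoidAlgebra.single σ (σ • y)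

/-- The defining multiplication rule `(σ y) (τ z) = (σ τ) (y ^ τ z)` of the twisted group ring. -/
theorem of_mul_of (σ τ : G) (y z : R) :
    of σ y * of τ z = of (σ * τ) ((τ⁻¹ • y) * z) := by
  simp [of, SkewMonoidAlgebra.single_mul_single, mul_smul]

end RightNotation

section FixedField

/-- A ring `S` that maps to the fixed field of `G` on `L` has `G`-linear scalar operation. -/
instance smulCommClass_of_fixedPoints {G L S : Type*} [Group G] [Field L] [MulSemiringAction G L]
    [CommRing S] [Algebra S L] [Algebra S (FixedPoints.subfield G L)]
    [IsScalarTower S (FixedPoints.subfield G L) L] : SMulCommClass G S L where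
  smul_comm g s x := by
    have h : g • algebraMap S L s = algebraMap S L s := by
      rw [IsScalarTower.algebraMap_apply S (FixedPoints.subfield G L) L]
      exact (algebraMap S (FixedPoints.subfield G L) s).2 g
    rw [Algebra.smul_def, Algebra.smul_def, smul_mul', h]

end FixedField

/-- `R / 𝔪R`, for an algebra `R` over the local ring `S` with maximal ideal `𝔪`. -/
abbrev Reduction (S R : Type*) [CommRing S] [IsLocalRing S] [CommRing R] [Algebra S R] : Type _ :=
  R ⧸ (IsLocalRing.maximalIdeal S).map (algebraMap S R)

/-- The dimension of the center of `A / Jac(A)` over the residue field of `S`. -/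
def dimCenter (S A : Type*) [CommRing S] [IsLocalRing S] [Ring A] [Algebra S A]
    [Algebra.IsIntegral S A] : ℕ :=
  Module.finrank (IsLocalRing.ResidueField S)
    (Subalgebra.center (IsLocalRing.ResidueField S) (A ⧸ Ring.jacobson A))

/-- The subspace `V_σ` of `R / Jac(R)` generated over the residue field of `S` by the elements
`(y ^ σ - y) z` and `y ^ ρ - y`, for `y, z` in `R / Jac(R)` and `ρ` in the centralizer of `σ`,
where `y ^ ρ` is written as `ρ⁻¹ • y`. -/
def V {G : Type*} (S R : Type*) [Group G] [CommRing S] [IsLocalRing S] [CommRing R] [Algebra S R]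
    [Algebra.IsIntegral S R] [MulSemiringAction G R] (σ : G) :
    Submodule (IsLocalRing.ResidueField S) (R ⧸ Ring.jacobson R) :=
  Submodule.span (IsLocalRing.ResidueField S)
    ({v | ∃ y z : R ⧸ Ring.jacobson R, v = (σ⁻¹ • y - y) * z} ∪
      {v | ∃ y : R ⧸ Ring.jacobson R, ∃ ρ ∈ Subgroup.centralizer {σ}, v = ρ⁻¹ • y - y})

/-- `C` is a system of representatives of the `p'`-conjugacy classes of `G`, i.e. of the classes
of elements of order prime to `p`. -/
structure IsPRegularRepresentatives {G : Type*} [Group G] (p : ℕ) (C : Finset G) : Prop where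
  not_dvd : ∀ σ ∈ C, ¬ p ∣ orderOf σ
  existsUnique : ∀ τ : G, ¬ p ∣ orderOf τ → ∃! σ, σ ∈ C ∧ IsConj σ τ

end TwistedGroupRing

end

/-! For a ring B let [B,B] be the additive group generated by the commutators. A finite semisimple B
is a product of matrix rings over finite fields. Scalars identify its centre, and the trace
identifies B/[B,B], with the product of these fields, so the centre can be counted through B/[B,B].

Let A be the twisted group ring over T/Jac(T) and B = A/Jac(A). The counting follows Brauer. In
characteristic p the map a ↦ a^(p^n) is additive modulo [A,A] (`add_pow_char_sub_mem_commutators`),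
and in B an element whose p^n-th power lies in [B,B] lies there itself
(`mem_commutators_of_pow_mem`). For a suitable n this map kills Jac(A), fixes σy modulo [A,A] for
p-regular σ, and carries every group element to a p-regular one. Hence the elements σy with σ in C
generate B modulo [B,B], and a sum ∑ σ y_σ that vanishes in B/[B,B] already lies in [A,A]. By
`of_mem_commutators` and `classCoeff_eq_zero` this means that each y_σ lies in V_σ. So |Z(B)| is the
product of the |(T/Jac(T))/V_σ|.

The rings Λ and Λ/πΛ have the same semisimple quotient as A, since coefficients that are nilpotent
modulo πT only contribute to the radical (`nonempty_ringEquiv_of_ker_pow_le`). Dimensions are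
recovered as exponents of the order of the residue field. -/

namespace TwistedGroupRing

/-! ### Additive commutators and p-th powers -/

section Commutators

variable {A B : Type*} [Ring A] [Ring B]

/-- The additive subgroup of a ring generated by the additive commutators `a * b - b * a`. -/
def commutators (A : Type*) [Ring A] : AddSubgroup A :=
  AddSubgroup.closure {x | ∃ a b : A, x = a * b - b * a}

theorem mul_sub_mul_mem_commutators (a b : A) : a * b - b * a ∈ commutators A :=
  AddSubgroup.subset_closure ⟨a, b, rfl⟩

theorem commutators_le_iff {H : AddSubgroup A} :
    commutators A ≤ H ↔ ∀ a b : A, a * b - b * a ∈ H := by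
  rw [commutators, AddSubgroup.closure_le]
  exact ⟨fun h a b => h ⟨a, b, rfl⟩, by rintro h _ ⟨a, b, rfl⟩; exact h a b⟩

theorem map_mem_commutators {F : Type*} [FunLike F A B] [NonUnitalRingHomClass F A B] (f : F)
    {a : A} (ha : a ∈ commutators A) : f a ∈ commutators B := by
  have h : commutators A ≤ (commutators B).comap (f : A →+ B) := by
    refine commutators_le_iff.2 fun x y => ?_
    simpa using mul_sub_mul_mem_commutators (f x) (f y)
  exact h ha

-- The variable is central, so each coefficient of [f, g] is a sum of commutators of coefficients of
-- f and g.
open Polynomial in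
theorem coeff_mem_commutators {f : A[X]} (hf : f ∈ commutators A[X]) (n : ℕ) :
    f.coeff n ∈ commutators A := by
  have h : commutators A[X] ≤ (commutators A).comap (lcoeff A n : A[X] →+ A) := by
    refine commutators_le_iff.2 fun f g => ?_
    rw [AddSubgroup.mem_comap]
    simp only [AddMonoidHom.coe_coe, lcoeff_apply, coeff_sub, coeff_mul]
    rw [← Finset.Nat.sum_antidiagonal_swap (f := fun x : ℕ × ℕ => g.coeff x.1 * f.coeff x.2),
      ← Finset.sum_sub_distrib]
    exact sum_mem fun x _ => mul_sub_mul_mem_commutators _ _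
  exact h hf

-- The power rule for derivatives survives modulo commutators, because factors may be rotated
-- cyclically. The prefix f ^ m gives the induction room to absorb the rotated factor. With n + 1 =
-- p the derivative of f ^ p becomes a sum of commutators.
open Polynomial in
theorem derivative_pow_sub_mem_commutators (f : A[X]) (n m : ℕ) :
    f ^ m * derivative (f ^ (n + 1)) - (n + 1) • (f ^ (m + n) * derivative f) ∈
      commutators A[X] := by
  induction n generalizing m with
  | zero => simp
  | succ n ih =>
    have h1 := ih (m + 1)
    have h2 := mul_sub_mul_mem_commutators (f ^ m * derivative (f ^ (n + 1))) f
    convert add_mem h1 h2 using 1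
    rw [pow_succ f (n + 1), derivative_mul, mul_add, succ_nsmul _ (n + 1), ← mul_assoc, ← mul_assoc,
      ← mul_assoc, ← pow_add, pow_succ' f m, mul_assoc f, show m + 1 + n = m + (n + 1) by ring]
    abel

variable {p : ℕ} [Fact p.Prime]

theorem mem_of_nsmul_mem {M : Type*} [AddCommGroup M] (H : AddSubgroup M) {x : M}
    (hx : p • x = 0) {n : ℕ} (hn : ¬ p ∣ n) (h : n • x ∈ H) : x ∈ H := by
  have hc : IsCoprime (n : ℤ) (p : ℤ) := Nat.isCoprime_iff_coprime.2
    ((Nat.Prime.coprime_iff_not_dvd Fact.out).2 hn).symm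
  obtain ⟨u, v, huv⟩ := hc
  have : x = u • (n • x) := by
    rw [← natCast_zsmul, ← mul_zsmul, eq_sub_of_add_eq huv, sub_zsmul, mul_zsmul, natCast_zsmul, hx]
    simp
  rw [this]
  exact H.zsmul_mem h u

open Polynomial in
/-- In characteristic `p`, the `p`-th power map is additive modulo additive commutators. -/
theorem add_pow_char_sub_mem_commutators (hp : (p : A) = 0) (a b : A) :
    (a + b) ^ p - (a ^ p + b ^ p) ∈ commutators A := by
  have hp0 : 0 < p := (Fact.out : p.Prime).pos
  -- The values of f ^ p at 0 and 1 are a ^ p and (a + b) ^ p, and its top coefficient is b ^ p. For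
  -- 0 < i < p the i-th coefficient times i is a coefficient of the derivative, hence lies in the
  -- commutators, and i is invertible modulo p.
  set f : A[X] := C a + C b * X with hf
  have hfd : f.natDegree ≤ 1 := by
    rw [hf, add_comm]; exact natDegree_linear_le
  have hd : ∀ i, i ≠ 0 → i < p → (f ^ p).coeff i ∈ commutators A := by
    intro i hi hip
    obtain ⟨i, rfl⟩ := Nat.exists_eq_succ_of_ne_zero hi
    have h1 := coeff_mem_commutators (derivative_pow_sub_mem_commutators f (p - 1) 0) i
    rw [Nat.sub_add_cancel hp0, coeff_sub, coeff_smul, ← Nat.cast_smul_eq_nsmul A p, hp, zero_smul,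
      sub_zero, pow_zero, one_mul, coeff_derivative] at h1
    refine mem_of_nsmul_mem (p := p) _ ?_ (Nat.not_dvd_of_pos_of_lt (Nat.succ_pos i) hip) ?_
    · rw [← Nat.cast_smul_eq_nsmul A p, hp, zero_smul]
    · rw [nsmul_eq_mul, Nat.cast_comm, Nat.cast_succ]
      exact h1
  -- Over a noncommutative ring, evaluation is multiplicative only at central points such as natural
  -- numbers.
  let ev (c : ℕ) : A[X] →+* A := eval₂RingHom' (RingHom.id A) c fun x => Nat.cast_comm c x |>.symm
  have hev : ∀ c g, ev c g = eval (c : A) g := fun c g => rfl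
  have h0 : (f ^ p).coeff 0 = a ^ p := by
    rw [coeff_zero_eq_eval_zero, ← Nat.cast_zero, ← hev, map_pow, hev, hf]
    simp
  have h1 : eval 1 (f ^ p) = (a + b) ^ p := by
    rw [← Nat.cast_one, ← hev, map_pow, hev, hf]
    simp
  have hpp : (f ^ p).coeff p = b ^ p := by
    have := coeff_pow_of_natDegree_le (m := p) hfd
    rw [mul_one] at this
    rw [this, hf]
    simp
  have hdeg : (f ^ p).natDegree < p + 1 :=
    Nat.lt_succ_of_le (natDegree_pow_le_of_le p hfd |>.trans (by simp))
  rw [← h1, eval_eq_sum_range' hdeg, Finset.sum_range_succ, ← Nat.sub_add_cancel hp0,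
    Finset.sum_range_succ', Nat.sub_add_cancel hp0, ← h0, ← hpp]
  simp only [one_pow, mul_one]
  rw [add_assoc, add_sub_cancel_right]
  refine sum_mem fun i hi => hd _ (Nat.succ_ne_zero _) ?_
  have := Finset.mem_range.1 hi
  omega

/-- By additivity (ab - ba)^p is congruent to (ab)^p - (ba)^p, which is the commutator of a and
b(ab)^(p-1). This makes the p-th power map descend to the quotient by commutators. -/
theorem pow_char_mem_commutators (hp : (p : A) = 0) {a : A} (ha : a ∈ commutators A) :
    a ^ p ∈ commutators A := by
  have hp0 : p ≠ 0 := (Fact.out : p.Prime).ne_zero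
  induction ha using AddSubgroup.closure_induction with
  | mem x hx =>
    obtain ⟨a, b, rfl⟩ := hx
    have h := add_pow_char_sub_mem_commutators hp (a * b - b * a) (b * a)
    rw [sub_add_cancel] at h
    have h2 : (a * b) ^ p - (b * a) ^ p ∈ commutators A := by
      obtain ⟨n, rfl⟩ := Nat.exists_eq_succ_of_ne_zero hp0
      convert mul_sub_mul_mem_commutators a (b * (a * b) ^ n) using 1
      have hs : b * (a * b) ^ n = (b * a) ^ n * b :=
        SemiconjBy.pow_right (by simp [SemiconjBy, mul_assoc]) n
      rw [Nat.succ_eq_add_one, pow_succ' (a * b), pow_succ, ← mul_assoc, ← mul_assoc, hs, mul_assoc,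
        hs, ← mul_assoc]
    convert sub_mem h2 h using 1
    abel
  | zero => rw [zero_pow hp0]; exact zero_mem _
  | add x y _ _ hx hy =>
    simpa using add_mem (add_pow_char_sub_mem_commutators hp x y) (add_mem hx hy)
  | neg x _ hx =>
    have h := add_pow_char_sub_mem_commutators hp x (-x)
    rw [add_neg_cancel, zero_pow hp0, zero_sub, neg_mem_iff] at h
    simpa using sub_mem h hx

theorem sub_pow_mem_commutators (hp : (p : A) = 0) {a b : A} (n : ℕ)
    (h : a - b ∈ commutators A) : a ^ p ^ n - b ^ p ^ n ∈ commutators A := by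
  induction n with
  | zero => simpa using h
  | succ n ih =>
    have h1 := add_pow_char_sub_mem_commutators hp (a ^ p ^ n - b ^ p ^ n) (b ^ p ^ n)
    rw [sub_add_cancel] at h1
    have := add_mem h1 (pow_char_mem_commutators hp ih)
    rw [pow_succ, pow_mul, pow_mul]
    convert this using 1
    abel

theorem add_pow_char_pow_sub_mem_commutators (hp : (p : A) = 0) (n : ℕ) (a b : A) :
    (a + b) ^ p ^ n - (a ^ p ^ n + b ^ p ^ n) ∈ commutators A := by
  induction n with
  | zero => simp
  | succ n ih =>
    have h1 := sub_pow_mem_commutators hp 1 ih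
    have h2 := add_pow_char_sub_mem_commutators hp (a ^ p ^ n) (b ^ p ^ n)
    rw [pow_one] at h1
    simpa [pow_succ, pow_mul] using add_mem h1 h2

/-- In characteristic `p`, the additive map on the quotient by additive commutators induced by
the `p ^ n`-th power map. -/
def powHom (hp : (p : A) = 0) (n : ℕ) : A →+ A ⧸ commutators A where
  toFun a := (a ^ p ^ n : A)
  map_zero' := by
    rw [zero_pow (pow_ne_zero _ (Fact.out : p.Prime).ne_zero)]
    rfl
  map_add' a b := by
    rw [← QuotientAddGroup.mk_add, eq_comm, QuotientAddGroup.eq, neg_add_eq_sub]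
    exact add_pow_char_pow_sub_mem_commutators hp n a b

theorem powHom_apply (hp : (p : A) = 0) (n : ℕ) (a : A) : powHom hp n a = (a ^ p ^ n : A) := rfl

theorem powHom_eq_zero_iff (hp : (p : A) = 0) (n : ℕ) (a : A) :
    powHom hp n a = 0 ↔ a ^ p ^ n ∈ commutators A :=
  QuotientAddGroup.eq_zero_iff _

theorem powHom_eq_of_sub_mem (hp : (p : A) = 0) (n : ℕ) {a b : A} (h : a - b ∈ commutators A) :
    powHom hp n a = powHom hp n b := by
  rw [eq_comm, powHom_apply, powHom_apply, QuotientAddGroup.eq, neg_add_eq_sub]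
  exact sub_pow_mem_commutators hp n h

end Commutators

/-! ### Traces on products of matrix rings over fields -/

section Trace

variable {n k : Type*} [Fintype n] [DecidableEq n] [CommRing k]

-- Off the diagonal, cE_ij = [E_ii, cE_ij]. On it, cE_ii - cE_00 = [cE_i0, E_0i], where 0 stands for
-- `i₀`.
open Matrix in
theorem sub_single_trace_mem_commutators (i₀ : n) (M : Matrix n n k) :
    M - single i₀ i₀ M.trace ∈ commutators (Matrix n n k) := by
  have h1 : M - single i₀ i₀ M.trace =
      ∑ i, ∑ j, (single i j (M i j) - if i = j then single i₀ i₀ (M i j) else 0) := by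
    simp only [Finset.sum_sub_distrib, Finset.sum_ite_eq, Finset.mem_univ, if_true]
    rw [← matrix_eq_sum_single, Matrix.trace]
    congr 1
    exact map_sum (singleAddMonoidHom i₀ i₀) _ _
  rw [h1]
  refine sum_mem fun i _ => sum_mem fun j _ => ?_
  split_ifs with hij
  · subst hij
    convert mul_sub_mul_mem_commutators (single i i₀ (M i i)) (single i₀ i 1) using 1
    simp
  · convert mul_sub_mul_mem_commutators (single i i 1) (single i j (M i j)) using 1
    simp [single_mul_single_of_ne, Ne.symm hij]

variable {ι : Type*} {d : ι → Type*} [∀ i, Fintype (d i)]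
  [∀ i, DecidableEq (d i)] {D : ι → Type*}

/-- The componentwise trace on a product of matrix rings. -/
def piTrace (d : ι → Type*) [∀ i, Fintype (d i)] (D : ι → Type*) [∀ i, Field (D i)] :
    (∀ i, Matrix (d i) (d i) (D i)) →+ ∀ i, D i where
  toFun M i := (M i).trace
  map_zero' := by ext; simp
  map_add' M N := by ext; simp

/-- The embedding of a product of fields into the corner idempotents of a product of matrix
rings. -/
def piCorner (D : ι → Type*) [∀ i, Field (D i)] (i₀ : ∀ i, d i) :
    (∀ i, D i) →ₙ+* ∀ i, Matrix (d i) (d i) (D i) where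
  toFun c i := Matrix.single (i₀ i) (i₀ i) (c i)
  map_zero' := by ext; simp
  map_add' M N := by ext; simp [Matrix.single_add]
  map_mul' M N := by ext; simp

variable [∀ i, Field (D i)]

theorem piTrace_piCorner (i₀ : ∀ i, d i) (c : ∀ i, D i) : piTrace d D (piCorner D i₀ c) = c := by
  ext i
  exact Matrix.trace_single_eq_same _ _

variable [Fintype ι] [DecidableEq ι]

theorem sub_piCorner_mem_commutators (i₀ : ∀ i, d i) (M : ∀ i, Matrix (d i) (d i) (D i)) :
    M - piCorner D i₀ (piTrace d D M) ∈ commutators (∀ i, Matrix (d i) (d i) (D i)) := by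
  have h : ∀ N : ∀ i, Matrix (d i) (d i) (D i), (∀ i, N i ∈ commutators _) → N ∈ commutators _ := by
    intro N hN
    rw [← Finset.univ_sum_single N]
    let s (i : ι) : Matrix (d i) (d i) (D i) →ₙ+* ∀ i, Matrix (d i) (d i) (D i) :=
      { AddMonoidHom.single (fun i => Matrix (d i) (d i) (D i)) i with
        map_mul' := fun x y => Pi.single_mul (α := fun i => Matrix (d i) (d i) (D i)) i x y }
    exact sum_mem fun i _ => map_mem_commutators (s i) (hN i)
  exact h _ fun i => sub_single_trace_mem_commutators (i₀ i) (M i)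

theorem ker_piTrace [∀ i, Nonempty (d i)] :
    (piTrace d D).ker = commutators (∀ i, Matrix (d i) (d i) (D i)) := by
  refine le_antisymm (fun M hM => ?_) (commutators_le_iff.2 fun M N => ?_)
  · have := sub_piCorner_mem_commutators (fun i => Classical.arbitrary (d i)) M
    rwa [AddMonoidHom.mem_ker.1 hM, map_zero, sub_zero] at this
  · ext i
    simp [piTrace, Matrix.trace_mul_comm (M i)]

/-- Modulo commutators M is the corner matrix of its trace c, so its power is the corner matrix of
the power of c. If that has trace zero, then c = 0 since a product of fields is reduced. -/
theorem mem_commutators_of_pow_mem_pi [∀ i, Nonempty (d i)] {p : ℕ} [Fact p.Prime]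
    (hp : (p : ∀ i, Matrix (d i) (d i) (D i)) = 0) (m : ℕ) {M : ∀ i, Matrix (d i) (d i) (D i)}
    (h : M ^ p ^ m ∈ commutators (∀ i, Matrix (d i) (d i) (D i))) :
    M ∈ commutators (∀ i, Matrix (d i) (d i) (D i)) := by
  let i₀ : ∀ i, d i := fun i => Classical.arbitrary (d i)
  have h1 := sub_pow_mem_commutators hp m (sub_piCorner_mem_commutators i₀ M)
  have hpm : p ^ m ≠ 0 := pow_ne_zero _ (Fact.out : p.Prime).ne_zero
  -- The corner embedding is not unital, so only positive exponents are compatible with it.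
  have hpow : ∀ k, ∀ c : ∀ i, D i, piCorner D i₀ c ^ (k + 1) = piCorner D i₀ (c ^ (k + 1)) := by
    intro k c
    induction k with
    | zero => simp
    | succ k ih => rw [pow_succ, ih, ← map_mul, ← pow_succ]
  obtain ⟨k, hk⟩ := Nat.exists_eq_succ_of_ne_zero hpm
  rw [hk] at h h1
  have h2 := sub_mem h h1
  rw [sub_sub_cancel, Nat.succ_eq_add_one, hpow, ← ker_piTrace, AddMonoidHom.mem_ker,
    piTrace_piCorner] at h2
  rw [← ker_piTrace, AddMonoidHom.mem_ker]
  exact eq_zero_of_pow_eq_zero h2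

/-- Both sides have the size of the product of the fields: the centre through scalar matrices, the
quotient through the trace. -/
theorem card_center_pi [∀ i, Nonempty (d i)] :
    Nat.card (Subring.center (∀ i, Matrix (d i) (d i) (D i))) =
      Nat.card ((∀ i, Matrix (d i) (d i) (D i)) ⧸ commutators (∀ i, Matrix (d i) (d i) (D i))) := by
  have h1 : Nat.card (∀ i, D i) = Nat.card (Subring.center (∀ i, Matrix (d i) (d i) (D i))) := by
    refine Nat.card_congr (Equiv.ofBijective
      (fun c => ⟨fun i => Matrix.scalar (d i) (c i), Subring.mem_center_iff.2 fun M => ?_⟩) ⟨?_, ?_⟩)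
    · ext1 i
      exact (Matrix.scalar_commute (c i) (fun r => Commute.all _ _) (M i)).symm
    · intro c c' h
      ext i
      exact Matrix.scalar_inj.1 (congrFun (Subtype.ext_iff.1 h) i)
    · rintro ⟨z, hz⟩
      have : ∀ i, z i ∈ Set.range (Matrix.scalar (d i)) := fun i =>
        Matrix.mem_range_scalar_of_commute_single fun a b _ => by
          have := congrFun (Subring.mem_center_iff.1 hz (Pi.single i (Matrix.single a b 1))) i
          simpa [Commute, SemiconjBy] using this
      choose c hc using this
      exact ⟨c, Subtype.ext (funext hc)⟩
  rw [← h1, ← ker_piTrace]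
  exact (Nat.card_congr (QuotientAddGroup.quotientKerEquivOfSurjective (piTrace d D) fun c =>
    ⟨_, piTrace_piCorner (fun i => Classical.arbitrary (d i)) c⟩).toEquiv).symm

end Trace

/-! ### Finite semisimple rings -/

section Semisimple

universe u

variable {B : Type u} {B' : Type*} [Ring B] [Ring B']

theorem mem_commutators_ringEquiv_iff (e : B ≃+* B') {b : B} :
    e b ∈ commutators B' ↔ b ∈ commutators B :=
  ⟨fun h => by simpa using map_mem_commutators e.symm h, map_mem_commutators e⟩

theorem map_commutators_ringEquiv (e : B ≃+* B') :
    (commutators B).map (e : B →+ B') = commutators B' := by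
  ext b
  refine ⟨?_, fun h => ⟨e.symm b, map_mem_commutators e.symm h, by simp⟩⟩
  rintro ⟨b, hb, rfl⟩
  exact map_mem_commutators e hb

theorem exists_ringEquiv_pi_matrix_field (B : Type u) [Ring B] [IsSemisimpleRing B] [Finite B] :
    ∃ (n : ℕ) (D : Fin n → Type u) (d : Fin n → ℕ) (_ : ∀ i, Field (D i)),
      (∀ i, NeZero (d i)) ∧ Nonempty (B ≃+* Π i, Matrix (Fin (d i)) (Fin (d i)) (D i)) := by
  obtain ⟨n, D, d, _, hd, ⟨e⟩⟩ := IsSemisimpleRing.exists_ringEquiv_pi_matrix_divisionRing B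
  -- Each division ring is the image of the finite ring under a matrix entry, so little Wedderburn
  -- makes it a field.
  have : ∀ i, Finite (D i) := fun i =>
    Finite.of_surjective (fun b : B => e b i 0 0) fun c =>
      ⟨e.symm (Pi.single i (Matrix.single 0 0 c)), by simp⟩
  exact ⟨n, D, d, fun i => littleWedderburn (D i), hd, ⟨e⟩⟩

theorem mem_commutators_of_pow_mem [IsSemisimpleRing B] [Finite B] {p : ℕ} [Fact p.Prime]
    (hp : (p : B) = 0) (m : ℕ) {b : B} (h : b ^ p ^ m ∈ commutators B) : b ∈ commutators B := by
  obtain ⟨n, D, d, _, _, ⟨e⟩⟩ := exists_ringEquiv_pi_matrix_field B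
  rw [← mem_commutators_ringEquiv_iff e] at h ⊢
  rw [map_pow] at h
  exact mem_commutators_of_pow_mem_pi (by rw [← map_natCast e, hp, map_zero]) m h

theorem card_center_eq_card_quotient_commutators [IsSemisimpleRing B] [Finite B] :
    Nat.card (Subring.center B) = Nat.card (B ⧸ commutators B) := by
  obtain ⟨n, D, d, _, _, ⟨e⟩⟩ := exists_ringEquiv_pi_matrix_field B
  rw [Nat.card_congr (Subring.centerCongr e).toEquiv, card_center_pi]
  exact (Nat.card_congr (QuotientAddGroup.congr _ _ (e : B ≃+ _)
    (map_commutators_ringEquiv e)).toEquiv).symm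

end Semisimple

/-! ### Commutators of the twisted group ring and the spaces V_σ -/

section SkewCommutators

variable {G R : Type*} [Group G] [CommRing R] [MulSemiringAction G R]

theorem of_zero (σ : G) : of σ (0 : R) = 0 := by simp [of]

theorem of_add (σ : G) (y z : R) : of σ (y + z) = of σ y + of σ z := by
  simp [of, smul_add, SkewMonoidAlgebra.single_add]

/-- The map `of σ` as an additive homomorphism. -/
noncomputable def ofHom (σ : G) : R →+ SkewMonoidAlgebra R G where
  toFun := of σ
  map_zero' := of_zero σ
  map_add' := of_add σ

theorem ofHom_apply (σ : G) (y : R) : ofHom σ y = of σ y := rfl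

theorem of_one_one : of (1 : G) (1 : R) = 1 := by
  rw [of, smul_one, SkewMonoidAlgebra.single_one_one]

theorem of_induction {P : SkewMonoidAlgebra R G → Prop} (h0 : P 0)
    (hof : ∀ σ y, P (of σ y)) (hadd : ∀ a b, P a → P b → P (a + b)) (a : SkewMonoidAlgebra R G) :
    P a := by
  rw [← SkewMonoidAlgebra.sum_single a, SkewMonoidAlgebra.sum_def, Finsupp.sum]
  refine Finset.sum_induction _ P hadd h0 fun σ _ => ?_
  have := hof σ (σ⁻¹ • a.coeff σ)
  rwa [of, smul_inv_smul] at this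

theorem of_pow (σ : G) (y : R) (n : ℕ) :
    of σ y ^ n = of (σ ^ n) (∏ i ∈ Finset.range n, (σ⁻¹) ^ i • y) := by
  induction n with
  | zero => simp [of_one_one]
  | succ n ih =>
    rw [pow_succ, ih, of_mul_of, ← pow_succ, Finset.prod_range_succ', Finset.smul_prod',
      pow_zero, one_smul]
    simp only [pow_succ', mul_smul]

/-- The difference is the commutator of ρ⁻¹ and τyρ. -/
theorem of_conj_sub_of_mem_commutators (ρ τ : G) (y : R) :
    of (ρ⁻¹ * τ * ρ) (ρ⁻¹ • y) - of τ y ∈ commutators (SkewMonoidAlgebra R G) := by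
  convert mul_sub_mul_mem_commutators (of ρ⁻¹ (1 : R)) (of τ y * of ρ (1 : R)) using 2
  · simp [of_mul_of, mul_assoc]
  · rw [mul_assoc]
    simp [of_mul_of, of_one_one]

/-- The additive subgroup of `R` generated by the elements `(y ^ σ - y) z` and `y ^ ρ - y`, for `ρ`
in the centralizer of `σ`. -/
def addV (R : Type*) [CommRing R] [MulSemiringAction G R] (σ : G) : AddSubgroup R :=
  AddSubgroup.closure
    ({v | ∃ y z : R, v = (σ⁻¹ • y - y) * z} ∪
      {v | ∃ y : R, ∃ ρ ∈ Subgroup.centralizer {σ}, v = ρ⁻¹ • y - y})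

theorem smul_sub_mul_mem_addV (σ : G) (y z : R) : (σ⁻¹ • y - y) * z ∈ addV R σ :=
  AddSubgroup.subset_closure (Or.inl ⟨y, z, rfl⟩)

theorem smul_sub_mem_addV {σ ρ : G} (h : ρ ∈ Subgroup.centralizer {σ}) (y : R) :
    ρ⁻¹ • y - y ∈ addV R σ :=
  AddSubgroup.subset_closure (Or.inr ⟨y, ρ, h, rfl⟩)

/-- The two kinds of generators of V_σ come from commutators of σz with a coefficient y, and from
conjugating σy by the centralizer of σ. -/
theorem of_mem_commutators {σ : G} {v : R} (hv : v ∈ addV R σ) :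
    of σ v ∈ commutators (SkewMonoidAlgebra R G) := by
  have h : addV R σ ≤ (commutators (SkewMonoidAlgebra R G)).comap (ofHom σ) := by
    rw [addV, AddSubgroup.closure_le]
    rintro v (⟨y, z, rfl⟩ | ⟨y, ρ, hρ, rfl⟩)
    · rw [SetLike.mem_coe, AddSubgroup.mem_comap]
      convert mul_sub_mul_mem_commutators (of (1 : G) y) (of σ z) using 1
      rw [of_mul_of, of_mul_of, one_mul, mul_one, inv_one, one_smul, ← ofHom_apply, ← ofHom_apply,
        ← map_sub, mul_comm z, sub_mul]
    · rw [SetLike.mem_coe, AddSubgroup.mem_comap]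
      convert of_conj_sub_of_mem_commutators ρ σ y using 1
      rw [map_sub, ofHom_apply, ofHom_apply, mul_assoc,
        ← Subgroup.mem_centralizer_singleton_iff.1 hρ, inv_mul_cancel_left]
  exact h hv

/-- V_σ need not be an ideal, but its first kind of generators spans one. Modulo that ideal σ acts
trivially, so the twisted product collapses to a power. -/
theorem prod_smul_sub_pow_mem_addV (σ : G) (y : R) (n : ℕ) :
    ∏ i ∈ Finset.range n, (σ⁻¹) ^ i • y - y ^ n ∈ addV R σ := by
  let I : Ideal R := Ideal.span {v | ∃ y : R, v = σ⁻¹ • y - y}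
  have hI : ∀ x ∈ I, x ∈ addV R σ := by
    have : ∀ x ∈ I, ∀ z, x * z ∈ addV R σ := by
      intro x hx
      induction hx using Submodule.span_induction with
      | mem x hx =>
        obtain ⟨y, rfl⟩ := hx
        exact smul_sub_mul_mem_addV σ y
      | zero => simp [zero_mem]
      | add a b _ _ ha hb => intro z; rw [add_mul]; exact add_mem (ha z) (hb z)
      | smul c a _ ha => intro z; rw [smul_eq_mul, mul_comm c, mul_assoc]; exact ha _
    intro x hx
    simpa using this x hx 1
  refine hI _ ?_
  rw [← Ideal.Quotient.eq, map_prod, map_pow, ← Finset.card_range n, ← Finset.prod_const,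
    Finset.card_range]
  refine Finset.prod_congr rfl fun i hi => ?_
  clear hi
  induction i with
  | zero => simp
  | succ i ih =>
    rw [← ih, pow_succ', mul_smul]
    exact Ideal.Quotient.eq.2 (Ideal.subset_span ⟨_, rfl⟩)

/-- If `σ ^ n = σ` and `n`-th powers are trivial on `R` then the `n`-th power map fixes `σ y`
modulo additive commutators. -/
theorem of_pow_sub_mem_commutators {n : ℕ} (hn : ∀ y : R, y ^ n = y) {σ : G} (hσ : σ ^ n = σ)
    (y : R) : of σ y ^ n - of σ y ∈ commutators (SkewMonoidAlgebra R G) := by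
  rw [of_pow, hσ, ← ofHom_apply, ← ofHom_apply, ← map_sub]
  have := prod_smul_sub_pow_mem_addV σ y n
  rw [hn] at this
  exact of_mem_commutators this

open Classical in
/-- The value on `τ y` of the projection of the twisted group ring to `R / V_σ`. -/
noncomputable def classCoeffOf (σ τ : G) : R →+ R ⧸ addV R σ :=
  if h : ∃ ρ : G, ρ⁻¹ * τ * ρ = σ then
    (QuotientAddGroup.mk' (addV R σ)).comp
      (DistribSMul.toAddMonoidHom R (h.choose)⁻¹)
  else 0

/-- Two elements conjugating τ to σ differ by an element of the centralizer of σ, which acts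
trivially modulo V_σ. So the choice in the definition does not matter. -/
theorem classCoeffOf_apply {σ τ : G} (ρ : G) (h : ρ⁻¹ * τ * ρ = σ) (y : R) :
    classCoeffOf σ τ y = (ρ⁻¹ • y : R) := by
  have hex : ∃ ρ : G, ρ⁻¹ * τ * ρ = σ := ⟨ρ, h⟩
  rw [classCoeffOf, dif_pos hex]
  have h₀ := hex.choose_spec
  set ρ₀ := hex.choose
  refine (QuotientAddGroup.eq.2 ?_)
  rw [neg_add_eq_sub]
  have hc : ρ₀⁻¹ * ρ ∈ Subgroup.centralizer {σ} := by
    rw [Subgroup.mem_centralizer_singleton_iff]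
    nth_rewrite 1 [← h]
    rw [← h₀]
    group
  convert smul_sub_mem_addV hc (ρ₀⁻¹ • y) using 1
  simp [smul_smul]

theorem classCoeffOf_eq_zero {σ τ : G} (h : ¬ IsConj σ τ) (y : R) :
    classCoeffOf σ τ y = 0 := by
  rw [classCoeffOf, dif_neg]
  · rfl
  · rintro ⟨ρ, hρ⟩
    refine h (isConj_iff.2 ⟨ρ, ?_⟩)
    rw [← hρ]
    group

/-- The projection of the twisted group ring to `R / V_σ`. -/
noncomputable def classCoeff (R : Type*) [CommRing R] [MulSemiringAction G R] (σ : G) :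
    SkewMonoidAlgebra R G →+ R ⧸ addV R σ :=
  (Finsupp.liftAddHom fun τ : G =>
    (classCoeffOf σ τ).comp (DistribSMul.toAddMonoidHom R τ⁻¹)).comp
  SkewMonoidAlgebra.coeffAddEquiv.toAddMonoidHom

theorem classCoeff_of (σ τ : G) (y : R) : classCoeff R σ (of τ y) = classCoeffOf σ τ y := by
  simp [classCoeff, of]

/-- This is the converse detection: the projection behaves like a trace. For monomials, ττ' and τ'τ
are conjugate by τ', and after transport to σ the two coefficients differ by a generator of V_σ of
the first kind. -/
theorem classCoeff_eq_zero {σ : G} {a : SkewMonoidAlgebra R G} (ha : a ∈ commutators _) :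
    classCoeff R σ a = 0 := by
  have h : commutators (SkewMonoidAlgebra R G) ≤ (classCoeff R σ).ker := by
    refine commutators_le_iff.2 fun a b => ?_
    rw [AddMonoidHom.mem_ker, map_sub, sub_eq_zero]
    induction a using of_induction with
    | h0 => simp
    | hadd a a' ha ha' => rw [add_mul, mul_add, map_add, map_add, ha, ha']
    | hof τ y =>
    induction b using of_induction with
    | h0 => simp
    | hadd a a' ha ha' => rw [add_mul, mul_add, map_add, map_add, ha, ha']
    | hof τ' z =>
    rw [of_mul_of, of_mul_of, classCoeff_of, classCoeff_of]
    by_cases hc : ∃ ρ : G, ρ⁻¹ * (τ * τ') * ρ = σ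
    · obtain ⟨ρ, hρ⟩ := hc
      rw [classCoeffOf_apply ρ hρ, classCoeffOf_apply (τ' * ρ) (by rw [← hρ]; group), eq_comm,
        QuotientAddGroup.eq, neg_add_eq_sub, ← neg_mem_iff]
      convert smul_sub_mul_mem_addV σ (ρ⁻¹ • z) (ρ⁻¹ • τ'⁻¹ • y) using 1
      rw [← hρ]
      simp only [smul_mul', smul_smul, mul_inv_rev, inv_inv, neg_sub, sub_mul]
      rw [show ρ⁻¹ * (τ'⁻¹ * τ⁻¹ * ρ) * ρ⁻¹ = ρ⁻¹ * τ'⁻¹ * τ⁻¹ by group]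
      ring
    · rw [classCoeffOf_eq_zero, classCoeffOf_eq_zero]
      · intro h
        obtain ⟨ρ, hρ⟩ := isConj_iff.1 h
        refine hc ⟨τ'⁻¹ * ρ, ?_⟩
        rw [show (τ'⁻¹ * ρ)⁻¹ * (τ * τ') * (τ'⁻¹ * ρ) = ρ⁻¹ * (τ' * τ) * ρ by group, ← hρ]
        group
      · intro h
        obtain ⟨ρ, hρ⟩ := isConj_iff.1 h
        exact hc ⟨ρ, by rw [← hρ]; group⟩
  exact h ha

end SkewCommutators

/-! ### Choice of the exponent n -/

section Exponent

variable {p : ℕ}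

/-- Frobenius is injective on a reduced ring, hence a permutation of a finite one; m is its order.
-/
theorem exists_pow_char_pow_eq [Fact p.Prime] (R : Type*) [CommRing R] [Finite R] [IsReduced R]
    (hp : (p : R) = 0) : ∃ m ≠ 0, ∀ y : R, y ^ p ^ m = y := by
  rcases subsingleton_or_nontrivial R with _ | _
  · exact ⟨1, one_ne_zero, fun y => Subsingleton.elim _ _⟩
  have : CharP R p := (CharP.charP_iff_prime_eq_zero Fact.out).2 hp
  let e : Equiv.Perm R := Equiv.ofBijective (frobenius R p)
    (Finite.injective_iff_bijective.1 (frobenius_inj R p))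
  refine ⟨orderOf e, (orderOf_pos e).ne', fun y => ?_⟩
  have h : ∀ k, (e ^ k) y = y ^ p ^ k := by
    intro k
    induction k with
    | zero => simp
    | succ k ih => rw [pow_succ' e, Equiv.Perm.mul_apply, ih, pow_succ, pow_mul]; rfl
  rw [← h, pow_orderOf_eq_one, Equiv.Perm.one_apply]

theorem pow_char_pow_mul_eq {M : Type*} [Monoid M] {m : ℕ} {y : M} (h : y ^ p ^ m = y) (j : ℕ) :
    y ^ p ^ (m * j) = y := by
  induction j with
  | zero => simp
  | succ j ih => rw [Nat.mul_succ, pow_add, pow_mul, ih, h]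

/-- A common exponent `n` for which `p ^ n`-th powers are trivial on a finite reduced ring of
characteristic `p`, are the projection to `p`-regular parts up to a power on a finite group, and
vanish on a nilpotent ideal. -/
theorem exists_regularizing_exponent [Fact p.Prime] (G R A : Type*) [Group G] [Finite G]
    [CommRing R] [Finite R] [IsReduced R] (hp : (p : R) = 0) [Ring A] [Finite A] :
    ∃ n : ℕ, (∀ y : R, y ^ p ^ n = y) ∧ (∀ τ : G, ¬ p ∣ orderOf (τ ^ p ^ n)) ∧
      (∀ τ : G, ¬ p ∣ orderOf τ → τ ^ p ^ n = τ) ∧ ∀ x ∈ Ring.jacobson A, x ^ p ^ n = 0 := by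
  have hprime : p.Prime := Fact.out
  obtain ⟨m₀, hm₀, hR⟩ := exists_pow_char_pow_eq R hp
  obtain ⟨a, m, hm, hG⟩ := Nat.exists_eq_pow_mul_and_not_dvd
    (Nat.card_pos (α := G)).ne' p hprime.ne_one
  obtain ⟨k, hk⟩ := IsSemiprimaryRing.isNilpotent (R := A)
  have hm0 : 0 < m := Nat.pos_of_ne_zero fun h => hm (h ▸ dvd_zero p)
  have hφ : 0 < m.totient := Nat.totient_pos.2 hm0
  have hle : a + k ≤ m₀ * m.totient * (a + k) :=
    Nat.le_mul_of_pos_left _ (Nat.mul_pos (Nat.pos_of_ne_zero hm₀) hφ)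
  have hcop : ∀ {l : ℕ}, ¬ p ∣ l → Nat.Coprime p l := fun h => (hprime.coprime_iff_not_dvd).2 h
  -- The factor m₀ handles R, and φ(m) gives p^n ≡ 1 modulo the p'-part m of |G|. The factor a + k
  -- forces n ≥ a, which removes the p-parts of group elements, and p^n > n ≥ k, which kills the
  -- radical.
  refine ⟨m₀ * m.totient * (a + k), fun y => ?_, fun τ h => ?_, fun τ h => ?_, fun x hx => ?_⟩
  · rw [mul_assoc]
    exact pow_char_pow_mul_eq (hR y) _
  · refine hm (h.trans (orderOf_dvd_of_pow_eq_one ?_))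
    rw [← pow_mul]
    refine orderOf_dvd_iff_pow_eq_one.1 ((orderOf_dvd_natCard τ).trans ?_)
    rw [hG]
    exact Nat.mul_dvd_mul_right (pow_dvd_pow p (by omega)) m
  · have hdvd : orderOf τ ∣ m := by
      refine Nat.Coprime.dvd_of_dvd_mul_left ?_ (hG ▸ orderOf_dvd_natCard τ)
      exact ((hcop h).pow_left a).symm
    have h1 : τ ^ p ^ m.totient = τ := by
      have := (Nat.ModEq.pow_totient (hcop hm)).of_dvd hdvd
      simpa using pow_eq_pow_iff_modEq.2 this
    rw [mul_comm m₀, mul_assoc]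
    exact pow_char_pow_mul_eq h1 _
  · have h1 : x ^ k = 0 := by
      have := Ideal.pow_mem_pow hx k
      rwa [hk] at this
    refine pow_eq_zero_of_le ?_ h1
    exact le_trans (by omega) (Nat.lt_pow_self hprime.one_lt).le

end Exponent

/-! ### Counting the centre over a finite reduced coefficient ring -/

section Count

variable {G R : Type*} [Group G] [CommRing R] [MulSemiringAction G R]

instance [Finite G] [Finite R] : Finite (SkewMonoidAlgebra R G) :=
  Finite.of_equiv (G → R)
    (SkewMonoidAlgebra.coeffAddEquiv.toEquiv.trans Finsupp.equivFunOnFinite).symm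

/-- The combination `∑ σ y_σ` in the twisted group ring. -/
noncomputable def sumOf (R : Type*) [CommRing R] [MulSemiringAction G R] (C : Finset G) :
    (C → R) →+ SkewMonoidAlgebra R G :=
  ∑ σ : C, (ofHom (σ : G)).comp (Pi.evalAddMonoidHom (fun _ : C => R) σ)

theorem sumOf_apply (C : Finset G) (y : C → R) : sumOf R C y = ∑ σ : C, of (σ : G) (y σ) := by
  simp [sumOf, ofHom_apply]

theorem sumOf_single [DecidableEq G] {C : Finset G} (σ : C) (y : R) :
    sumOf R C (Pi.single σ y) = of (σ : G) y := by
  rw [sumOf_apply, Finset.sum_eq_single σ]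
  · simp
  · intro τ _ h
    rw [Pi.single_eq_of_ne h, of_zero]
  · simp

variable {p : ℕ} {C : Finset G}

theorem IsPRegularRepresentatives.eq_of_isConj (hC : IsPRegularRepresentatives p C) {σ τ : G}
    (hσ : σ ∈ C) (hτ : τ ∈ C) (h : IsConj σ τ) : σ = τ :=
  (hC.existsUnique τ (hC.not_dvd τ hτ)).unique ⟨hσ, h⟩ ⟨hτ, IsConj.refl τ⟩

theorem classCoeff_sumOf (hC : IsPRegularRepresentatives p C) (y : C → R) (σ : C) :
    classCoeff R (σ : G) (sumOf R C y) = (y σ : R) := by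
  rw [sumOf_apply, map_sum, Finset.sum_eq_single σ]
  · rw [classCoeff_of, classCoeffOf_apply 1 (by simp)]
    simp
  · intro τ _ hτ
    rw [classCoeff_of, classCoeffOf_eq_zero]
    exact fun h => hτ (Subtype.ext (hC.eq_of_isConj σ.2 τ.2 h).symm)
  · simp

/-- The number of elements of the center of the semisimple quotient of the twisted group ring over
a finite reduced ring of prime characteristic. -/
theorem card_center_quotient_jacobson [Fact p.Prime] [Finite G] [Finite R] [IsReduced R]
    (hp : (p : R) = 0) (hC : IsPRegularRepresentatives p C) :
    Nat.card (Subring.center (SkewMonoidAlgebra R G ⧸ Ring.jacobson (SkewMonoidAlgebra R G))) =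
      ∏ σ ∈ C, Nat.card (R ⧸ addV R σ) := by
  classical
  have hpA : (p : SkewMonoidAlgebra R G) = 0 := by
    rw [SkewMonoidAlgebra.natCast_def, hp, SkewMonoidAlgebra.single_zero]
  obtain ⟨n, hR, hreg, hfix, hJ⟩ :=
    exists_regularizing_exponent G R (SkewMonoidAlgebra R G) hp
  let q := Ideal.Quotient.mk (Ring.jacobson (SkewMonoidAlgebra R G))
  have hq : Function.Surjective q := Ideal.Quotient.mk_surjective
  have : Finite (SkewMonoidAlgebra R G ⧸ Ring.jacobson (SkewMonoidAlgebra R G)) :=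
    Finite.of_surjective q hq
  let θ : (C → R) →+ (SkewMonoidAlgebra R G ⧸ Ring.jacobson (SkewMonoidAlgebra R G)) ⧸
      commutators (SkewMonoidAlgebra R G ⧸ Ring.jacobson (SkewMonoidAlgebra R G)) :=
    ((QuotientAddGroup.mk' _).comp (q : _ →+ _)).comp (sumOf R C)
  have hθ : ∀ y, θ y = 0 ↔ q (sumOf R C y) ∈ commutators _ := fun y =>
    QuotientAddGroup.eq_zero_iff _
  let π : (C → R) →+ ∀ σ : C, R ⧸ addV R (σ : G) :=
    { toFun := fun y σ => (y σ : R)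
      map_zero' := rfl
      map_add' := fun _ _ => rfl }
  have hfixof : ∀ σ ∈ C, ∀ y, powHom hpA n (of σ y) = (of σ y : SkewMonoidAlgebra R G) := by
    intro σ hσ y
    rw [powHom_apply, eq_comm, QuotientAddGroup.eq, neg_add_eq_sub]
    exact of_pow_sub_mem_commutators hR (hfix σ (hC.not_dvd σ hσ)) y
  have hker : θ.ker = π.ker := by
    ext y
    rw [AddMonoidHom.mem_ker, AddMonoidHom.mem_ker, hθ]
    constructor
    · intro h
      have hmap : commutators (SkewMonoidAlgebra R G ⧸ Ring.jacobson (SkewMonoidAlgebra R G)) ≤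
          (commutators (SkewMonoidAlgebra R G)).map (q : _ →+ _) := by
        refine commutators_le_iff.2 fun a b => ?_
        obtain ⟨a, rfl⟩ := hq a
        obtain ⟨b, rfl⟩ := hq b
        exact ⟨_, mul_sub_mul_mem_commutators a b, by simp⟩
      -- The sum is a commutator part k plus a radical element. The p^n-th power map kills both
      -- modulo commutators and fixes the sum, so the sum itself lies in the commutators before
      -- passing to the quotient.
      obtain ⟨k, hk, hkq⟩ := hmap h
      have h1 : powHom hpA n (sumOf R C y - k) = 0 := by
        rw [powHom_apply, hJ _ (Ideal.Quotient.eq.1 hkq.symm)]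
        rfl
      have h2 : powHom hpA n k = 0 := by
        rw [powHom_eq_of_sub_mem hpA n (b := 0) (by simpa using hk), map_zero]
      rw [map_sub, h2, sub_zero, sumOf_apply, map_sum] at h1
      have h3 : ((sumOf R C y : SkewMonoidAlgebra R G) :
          SkewMonoidAlgebra R G ⧸ commutators (SkewMonoidAlgebra R G)) = 0 := by
        rw [← h1, sumOf_apply]
        exact (map_sum (QuotientAddGroup.mk' (commutators (SkewMonoidAlgebra R G))) _ _).trans
          (Finset.sum_congr rfl fun σ _ => (hfixof σ σ.2 _).symm)
      have h4 := (QuotientAddGroup.eq_zero_iff _).1 h3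
      ext σ
      exact (classCoeff_sumOf hC y σ).symm.trans (classCoeff_eq_zero h4)
    · intro h
      rw [sumOf_apply, map_sum]
      exact sum_mem fun σ _ => map_mem_commutators q
        (of_mem_commutators ((QuotientAddGroup.eq_zero_iff _).1 (congrFun h σ)))
  have hθs : Function.Surjective θ := by
    intro b
    obtain ⟨b, rfl⟩ := QuotientAddGroup.mk_surjective b
    obtain ⟨a, rfl⟩ := hq b
    rw [← Set.mem_range, ← AddMonoidHom.coe_range]
    induction a using of_induction with
    | h0 => exact zero_mem θ.range
    | hadd a a' ha ha' => exact add_mem (S := AddSubgroup _) ha ha'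
    | hof τ y =>
    -- The p^n-th power of τy is τ^(p^n) w, conjugate to a monomial at some σ in C that the power
    -- map fixes. So τy and this monomial have congruent p^n-th powers, and in the semisimple
    -- quotient they are congruent themselves.
    obtain ⟨σ, ⟨hσ, hc⟩, -⟩ := hC.existsUnique _ (hreg τ)
    obtain ⟨ρ, hρ⟩ := isConj_iff.1 hc
    set w := ∏ i ∈ Finset.range (p ^ n), (τ⁻¹) ^ i • y
    refine ⟨Pi.single ⟨σ, hσ⟩ (ρ⁻¹ • w), ?_⟩
    refine (QuotientAddGroup.eq.2 ?_ : QuotientAddGroup.mk (q _) = QuotientAddGroup.mk (q _))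
    rw [sumOf_single, neg_add_eq_sub, ← map_sub]
    refine mem_commutators_of_pow_mem (by rw [← map_natCast q, hpA, map_zero]) n ?_
    rw [← map_pow]
    refine map_mem_commutators q ((powHom_eq_zero_iff hpA n _).1 ?_)
    rw [map_sub, hfixof σ hσ, powHom_apply, of_pow, sub_eq_zero]
    refine QuotientAddGroup.eq.2 ?_
    rw [neg_add_eq_sub]
    convert of_conj_sub_of_mem_commutators ρ (τ ^ p ^ n) w using 3
    rw [← hρ]
    group
  have hπs : Function.Surjective π := fun z =>
    ⟨fun σ => (z σ).out, funext fun σ => QuotientAddGroup.out_eq' _⟩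
  rw [card_center_eq_card_quotient_commutators, ← Finset.prod_coe_sort, ← Nat.card_pi]
  exact Nat.card_congr ((QuotientAddGroup.quotientKerEquivOfSurjective θ hθs).symm.trans
    ((QuotientAddGroup.quotientAddEquivOfEq hker).trans
      (QuotientAddGroup.quotientKerEquivOfSurjective π hπs))).toEquiv

end Count

/-! ### Surjections with kernel in the radical -/

section JacobsonQuotient

variable {A B : Type*} [Ring A] [Ring B]

/-- A left ideal that consists of elements that are nilpotent modulo the Jacobson radical is
contained in the Jacobson radical. -/
theorem le_jacobson_of_pow_mem {I : Ideal A} (h : ∀ x ∈ I, ∃ k : ℕ, x ^ k ∈ Ring.jacobson A) :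
    I ≤ Ring.jacobson A := by
  intro x hx
  rw [← Ideal.jacobson_bot, ← Ideal.jacobson_idem, Ideal.mem_jacobson_iff]
  intro y
  obtain ⟨k, hk⟩ := h (y * x) (I.mul_mem_left y hx)
  -- The geometric series is a left inverse of 1 + yx modulo the radical.
  refine ⟨∑ i ∈ Finset.range k, (-(y * x)) ^ i, ?_⟩
  have h1 := geom_sum_mul_neg (-(y * x)) k
  rw [sub_neg_eq_add, mul_add, mul_one, add_comm, ← mul_assoc] at h1
  rw [h1, sub_sub_cancel_left, Ideal.jacobson_bot, neg_mem_iff, neg_pow]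
  exact Ideal.mul_mem_left _ _ hk

/-- A surjection with kernel in the Jacobson radical induces an isomorphism of the quotients by the
Jacobson radicals. -/
theorem nonempty_ringEquiv_quotient_jacobson (f : A →+* B) (hf : Function.Surjective f)
    (hker : RingHom.ker f ≤ Ring.jacobson A) :
    Nonempty (A ⧸ Ring.jacobson A ≃+* B ⧸ Ring.jacobson B) := by
  have : RingHomSurjective f := ⟨hf⟩
  let g := (Ideal.Quotient.mk (Ring.jacobson B)).comp f
  have hg : Function.Surjective g := Ideal.Quotient.mk_surjective.comp hf
  have hgker : RingHom.ker g = Ring.jacobson A := by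
    ext x
    rw [RingHom.mem_ker, RingHom.comp_apply, Ideal.Quotient.eq_zero_iff_mem]
    exact SetLike.ext_iff.1
      (Module.comap_jacobson_of_ker_le (f := f.toSemilinearMap) hf hker) x
  exact ⟨(Ideal.quotEquivOfEq hgker.symm).trans (RingHom.quotientKerEquivOfSurjective hg)⟩

end JacobsonQuotient

/-! ### Change of coefficients -/

section MapCoeff

variable {G R R' : Type*} [Group G] [CommRing R] [MulSemiringAction G R]
  [CommRing R'] [MulSemiringAction G R']

/-- The twisted group ring is functorial in the coefficient ring. -/
noncomputable def mapCoeff (f : R →+* R') (hf : ∀ (g : G) (x : R), f (g • x) = g • f x) :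
    SkewMonoidAlgebra R G →+* SkewMonoidAlgebra R' G :=
  let φ : SkewMonoidAlgebra R G →+ SkewMonoidAlgebra R' G :=
    SkewMonoidAlgebra.coeffAddEquiv.symm.toAddMonoidHom.comp
      ((Finsupp.mapRange.addMonoidHom f.toAddMonoidHom).comp
        SkewMonoidAlgebra.coeffAddEquiv.toAddMonoidHom)
  have hφ : ∀ σ y, φ (of σ y) = of σ (f y) := fun σ y => by
    simp [φ, of, hf]
  { φ with
    map_one' := by
      have := hφ 1 1
      rwa [map_one, of_one_one, of_one_one] at this
    map_mul' := fun a b => by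
      change φ (a * b) = φ a * φ b
      induction a using of_induction with
      | h0 => simp
      | hadd a a' ha ha' => rw [add_mul, map_add, map_add, add_mul, ha, ha']
      | hof σ y =>
      induction b using of_induction with
      | h0 => simp
      | hadd b b' hb hb' => rw [mul_add, map_add, map_add, mul_add, hb, hb']
      | hof τ z => simp [of_mul_of, hφ, hf] }

theorem coeff_mapCoeff (f : R →+* R') (hf : ∀ (g : G) (x : R), f (g • x) = g • f x)
    (a : SkewMonoidAlgebra R G) (g : G) : (mapCoeff f hf a).coeff g = f (a.coeff g) := rfl

theorem mapCoeff_of (f : R →+* R') (hf : ∀ (g : G) (x : R), f (g • x) = g • f x)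
    (σ : G) (y : R) : mapCoeff f hf (of σ y) = of σ (f y) := by
  ext g
  classical
  rw [coeff_mapCoeff, of, of, SkewMonoidAlgebra.coeff_single_apply,
    SkewMonoidAlgebra.coeff_single_apply, apply_ite f, hf, map_zero]

theorem mapCoeff_surjective {f : R →+* R'} (hf : ∀ (g : G) (x : R), f (g • x) = g • f x)
    (hs : Function.Surjective f) : Function.Surjective (mapCoeff f hf) := by
  intro a
  induction a using of_induction with
  | h0 => exact ⟨0, map_zero _⟩
  | hadd a b ha hb =>
    obtain ⟨a, rfl⟩ := ha
    obtain ⟨b, rfl⟩ := hb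
    exact ⟨a + b, map_add _ _ _⟩
  | hof σ y =>
    obtain ⟨y, rfl⟩ := hs y
    exact ⟨of σ y, mapCoeff_of f hf σ y⟩

theorem coeff_mul_mem {I J : Ideal R} (hJ : ∀ (g : G), ∀ x ∈ J, g • x ∈ J)
    {a b : SkewMonoidAlgebra R G} (ha : ∀ g, a.coeff g ∈ I) (hb : ∀ g, b.coeff g ∈ J) (g : G) :
    (a * b).coeff g ∈ I * J := by
  classical
  rw [SkewMonoidAlgebra.coeff_mul, SkewMonoidAlgebra.sum_def]
  refine sum_mem fun σ _ => ?_
  beta_reduce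
  rw [SkewMonoidAlgebra.sum_def]
  refine sum_mem fun τ _ => ?_
  beta_reduce
  split_ifs
  · exact Ideal.mul_mem_mul (ha σ) (hJ _ _ (hb τ))
  · exact zero_mem _

theorem coeff_pow_mem {I : Ideal R} (hI : ∀ (g : G), ∀ x ∈ I, g • x ∈ I)
    {a : SkewMonoidAlgebra R G} (ha : ∀ g, a.coeff g ∈ I) (k : ℕ) (g : G) :
    (a ^ k).coeff g ∈ I ^ k := by
  induction k generalizing g with
  | zero => simp
  | succ k ih => rw [pow_succ, pow_succ]; exact coeff_mul_mem hI ih ha g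

variable {S : Type*} [CommRing S] [IsLocalRing S] [Algebra S R] [SMulCommClass G S R]
  [Finite G] [Algebra.IsIntegral S R]

/-- By integrality the maximal ideal of S maps into the radical, which is two-sided and so absorbs
the coefficients and the group elements. -/
theorem mem_jacobson_of_coeff_mem {a : SkewMonoidAlgebra R G}
    (ha : ∀ g, a.coeff g ∈ (IsLocalRing.maximalIdeal S).map (algebraMap S R)) :
    a ∈ Ring.jacobson (SkewMonoidAlgebra R G) := by
  have h : ∀ (σ : G), ∀ c ∈ (IsLocalRing.maximalIdeal S).map (algebraMap S R),
      SkewMonoidAlgebra.single σ c ∈ Ring.jacobson (SkewMonoidAlgebra R G) := by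
    intro σ c hc
    induction hc using Submodule.span_induction with
    | mem c hc =>
      obtain ⟨s, hs, rfl⟩ := hc
      have h1 : algebraMap S (SkewMonoidAlgebra R G) s ∈ Ring.jacobson (SkewMonoidAlgebra R G) :=
        maximalIdeal_le_comap_jacobson hs
      rw [Algebra.algebraMap_eq_smul_one]
      have := (Ring.jacobson (SkewMonoidAlgebra R G)).mul_mem_right
        (SkewMonoidAlgebra.single σ 1) h1
      rwa [Algebra.algebraMap_eq_smul_one, smul_mul_assoc, one_mul,
        SkewMonoidAlgebra.smul_single] at this
    | zero => rw [SkewMonoidAlgebra.single_zero]; exact zero_mem _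
    | add c d _ _ hc hd => rw [SkewMonoidAlgebra.single_add]; exact add_mem hc hd
    | smul r c _ hc =>
      have := (Ring.jacobson (SkewMonoidAlgebra R G)).mul_mem_left
        (SkewMonoidAlgebra.single 1 r) hc
      rwa [SkewMonoidAlgebra.single_mul_single, one_mul, one_smul] at this
  rw [← SkewMonoidAlgebra.sum_single a, SkewMonoidAlgebra.sum_def]
  exact sum_mem fun σ _ => h σ _ (ha σ)

/-- An equivariant surjection of the coefficient rings with kernel nilpotent modulo the maximal
ideal of `S` induces an isomorphism of the semisimple quotients of the twisted group rings. -/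
theorem nonempty_ringEquiv_of_ker_pow_le (f : R →+* R')
    (hf : ∀ (g : G) (x : R), f (g • x) = g • f x) (hs : Function.Surjective f) {k : ℕ}
    (hk : RingHom.ker f ^ k ≤ (IsLocalRing.maximalIdeal S).map (algebraMap S R)) :
    Nonempty (SkewMonoidAlgebra R G ⧸ Ring.jacobson (SkewMonoidAlgebra R G) ≃+*
      SkewMonoidAlgebra R' G ⧸ Ring.jacobson (SkewMonoidAlgebra R' G)) := by
  refine nonempty_ringEquiv_quotient_jacobson _ (mapCoeff_surjective hf hs)
    (le_jacobson_of_pow_mem fun x hx => ⟨k, mem_jacobson_of_coeff_mem (S := S) fun g => hk ?_⟩)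
  refine coeff_pow_mem (fun g x hx => ?_) (fun g => ?_) k g
  · rw [RingHom.mem_ker] at hx ⊢
    rw [hf, hx, smul_zero]
  · rw [RingHom.mem_ker, ← coeff_mapCoeff f hf, RingHom.mem_ker.1 hx]
    rfl

end MapCoeff

/-! ### From cardinalities to dimensions -/

section Dimension

/-- Passing to cardinalities lets bare ring isomorphisms compare dimensions, with no linearity to
check. -/
theorem card_residueField_pow_dimCenter (S A : Type*) [CommRing S] [IsLocalRing S] [Ring A]
    [Algebra S A] [Algebra.IsIntegral S A] [Finite (A ⧸ Ring.jacobson A)] :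
    Nat.card (IsLocalRing.ResidueField S) ^ dimCenter S A =
      Nat.card (Subring.center (A ⧸ Ring.jacobson A)) := by
  have : Finite (Subalgebra.center (IsLocalRing.ResidueField S) (A ⧸ Ring.jacobson A)) :=
    Subtype.finite
  exact (Module.natCard_eq_pow_finrank (K := IsLocalRing.ResidueField S)).symm

variable {S R : Type*} [CommRing S] [IsLocalRing S] [CommRing R] [Algebra S R]

theorem finite_reduction [Module.Finite S R] [Finite (IsLocalRing.ResidueField S)] :
    Finite (Reduction S R) := by
  have : Finite (S ⧸ IsLocalRing.maximalIdeal S) := ‹Finite (IsLocalRing.ResidueField S)›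
  have : Module.Finite (S ⧸ IsLocalRing.maximalIdeal S) (Reduction S R) :=
    Module.Finite.of_restrictScalars_finite S _ _
  exact Module.finite_of_finite (S ⧸ IsLocalRing.maximalIdeal S)

theorem exists_jacobson_pow_le [Finite (Reduction S R)] :
    ∃ k : ℕ, Ring.jacobson R ^ k ≤ (IsLocalRing.maximalIdeal S).map (algebraMap S R) := by
  obtain ⟨k, hk⟩ := IsSemiprimaryRing.isNilpotent (R := Reduction S R)
  refine ⟨k, ?_⟩
  have h : (Ring.jacobson R).map (Ideal.Quotient.mk _) ≤ Ring.jacobson (Reduction S R) :=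
    Ideal.map_le_iff_le_comap.2 (Ring.le_comap_jacobson _)
  have h1 := Ideal.pow_right_mono h k
  rw [← Ideal.map_pow, hk, Ideal.zero_eq_bot, le_bot_iff, Ideal.map_eq_bot_iff_le_ker,
    Ideal.mk_ker] at h1
  exact h1

variable [Algebra.IsIntegral S R]

theorem mk_smul_mk (s : S) (x : R) :
    IsLocalRing.residue S s • Ideal.Quotient.mk (Ring.jacobson R) x =
      Ideal.Quotient.mk (Ring.jacobson R) (s • x) := by
  rw [Algebra.smul_def, Algebra.smul_def, map_mul]
  rfl

/-- Scalars commute with G, so they preserve both kinds of generators and the additive span is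
already a subspace. -/
theorem toAddSubgroup_V {G : Type*} [Group G] [MulSemiringAction G R] [SMulCommClass G S R]
    (σ : G) : (V S R σ).toAddSubgroup = addV (R ⧸ Ring.jacobson R) σ := by
  have hcomm : ∀ (c : IsLocalRing.ResidueField S) (g : G) (x : R ⧸ Ring.jacobson R),
      c • g • x = g • c • x := by
    intro c g x
    obtain ⟨s, rfl⟩ := IsLocalRing.residue_surjective c
    obtain ⟨x, rfl⟩ := Ideal.Quotient.mk_surjective x
    change _ • Ideal.Quotient.mk _ (g • x) = _
    rw [mk_smul_mk, mk_smul_mk, ← smul_comm]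
    rfl
  have hsmul : ∀ (c : IsLocalRing.ResidueField S), ∀ v ∈ addV (R ⧸ Ring.jacobson R) σ,
      c • v ∈ addV (R ⧸ Ring.jacobson R) σ := by
    intro c v hv
    induction hv using AddSubgroup.closure_induction with
    | mem v hv =>
      rcases hv with ⟨y, z, rfl⟩ | ⟨y, ρ, hρ, rfl⟩
      · rw [← mul_smul_comm]
        exact smul_sub_mul_mem_addV σ y _
      · rw [smul_sub, hcomm]
        exact smul_sub_mem_addV hρ _
    | zero => rw [smul_zero]; exact zero_mem _
    | add a b _ _ ha hb => rw [smul_add]; exact add_mem ha hb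
    | neg a _ ha => rw [smul_neg]; exact neg_mem ha
  refine le_antisymm (fun v hv => ?_) ?_
  · let W : Submodule (IsLocalRing.ResidueField S) (R ⧸ Ring.jacobson R) :=
      { (addV (R ⧸ Ring.jacobson R) σ) with smul_mem' := fun c v hv => hsmul c v hv }
    have : V S R σ ≤ W := Submodule.span_le.2 AddSubgroup.subset_closure
    exact this hv
  · rw [addV, AddSubgroup.closure_le]
    exact Submodule.subset_span

theorem card_quotient_addV {G : Type*} [Group G] [MulSemiringAction G R] [SMulCommClass G S R]
    [Finite (R ⧸ Ring.jacobson R)] (σ : G) :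
    Nat.card ((R ⧸ Ring.jacobson R) ⧸ addV (R ⧸ Ring.jacobson R) σ) =
      Nat.card (IsLocalRing.ResidueField S) ^
        Module.finrank (IsLocalRing.ResidueField S) ((R ⧸ Ring.jacobson R) ⧸ V S R σ) := by
  rw [← toAddSubgroup_V (S := S) σ]
  exact Module.natCard_eq_pow_finrank (V := (R ⧸ Ring.jacobson R) ⧸ V S R σ)

theorem finite_quotient_jacobson [Finite (Reduction S R)] : Finite (R ⧸ Ring.jacobson R) :=
  Finite.of_surjective _ (Ideal.Quotient.factor_surjective
    (Ideal.map_le_iff_le_comap.2 (maximalIdeal_le_comap_jacobson (S := S))))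

theorem isReduced_quotient_jacobson (R : Type*) [CommRing R] : IsReduced (R ⧸ Ring.jacobson R) := by
  rw [← Ideal.isRadical_iff_quotient_reduced, ← Ideal.jacobson_bot]
  exact Ideal.isRadical_jacobson ⊥

end Dimension

end TwistedGroupRing

theorem mainTheorem2 {G L S : Type*} [Group G] [Finite G] [Field L] [MulSemiringAction G L]
    [CommRing S] [IsDomain S] [IsDiscreteValuationRing S]
    [Algebra S (FixedPoints.subfield G L)] [IsFractionRing S (FixedPoints.subfield G L)]
    [Algebra S L] [IsScalarTower S (FixedPoints.subfield G L) L]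
    [Finite (IsLocalRing.ResidueField S)]
    (p : ℕ) [CharP (IsLocalRing.ResidueField S) p]
    (C : Finset G) (hC : TwistedGroupRing.IsPRegularRepresentatives p C) :
    TwistedGroupRing.dimCenter S (SkewMonoidAlgebra (integralClosure S L) G) =
        TwistedGroupRing.dimCenter S
          (SkewMonoidAlgebra (TwistedGroupRing.Reduction S (integralClosure S L)) G) ∧
      TwistedGroupRing.dimCenter S
          (SkewMonoidAlgebra (TwistedGroupRing.Reduction S (integralClosure S L)) G) =
        ∑ σ ∈ C, Module.finrank (IsLocalRing.ResidueField S)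
          ((integralClosure S L ⧸ Ring.jacobson (integralClosure S L)) ⧸
            TwistedGroupRing.V S (integralClosure S L) σ) := by
  open TwistedGroupRing in
  set T := integralClosure S L
  -- L is finite and separable over the fixed field of a finite group, so the integral closure is
  -- finite over S.
  have : Module.Finite S T := IsIntegralClosure.finite S (FixedPoints.subfield G L) L T
  have : Finite (Reduction S T) := finite_reduction
  have : Finite (T ⧸ Ring.jacobson T) := finite_quotient_jacobson (S := S)
  have : IsReduced (T ⧸ Ring.jacobson T) := isReduced_quotient_jacobson T
  have : Fact p.Prime := ⟨CharP.char_is_prime (IsLocalRing.ResidueField S) p⟩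
  have hp : (p : T ⧸ Ring.jacobson T) = 0 := by
    rw [← map_natCast (algebraMap (IsLocalRing.ResidueField S) (T ⧸ Ring.jacobson T)),
      CharP.cast_eq_zero, map_zero]
  obtain ⟨k, hk⟩ := exists_jacobson_pow_le (S := S) (R := T)
  obtain ⟨e₀⟩ := nonempty_ringEquiv_of_ker_pow_le (S := S) (G := G)
    (Ideal.Quotient.mk (Ring.jacobson T)) (fun _ _ => rfl) Ideal.Quotient.mk_surjective
    (k := k) (by rwa [Ideal.mk_ker])
  obtain ⟨e₁⟩ := nonempty_ringEquiv_of_ker_pow_le (S := S) (G := G)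
    (Ideal.Quotient.mk ((IsLocalRing.maximalIdeal S).map (algebraMap S T))) (fun _ _ => rfl)
    Ideal.Quotient.mk_surjective (k := 1) (by rw [Ideal.mk_ker, pow_one])
  have hfin₀ : Finite (SkewMonoidAlgebra (T ⧸ Ring.jacobson T) G ⧸
      Ring.jacobson (SkewMonoidAlgebra (T ⧸ Ring.jacobson T) G)) :=
    Finite.of_surjective _ Ideal.Quotient.mk_surjective
  have hfin : Finite (SkewMonoidAlgebra T G ⧸ Ring.jacobson (SkewMonoidAlgebra T G)) :=
    Finite.of_equiv _ e₀.symm.toEquiv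
  have hfin₁ : Finite (SkewMonoidAlgebra (Reduction S T) G ⧸
      Ring.jacobson (SkewMonoidAlgebra (Reduction S T) G)) :=
    Finite.of_equiv _ e₁.toEquiv
  -- The residue field has more than one element, so its powers determine their exponents.
  have hq := Nat.pow_right_injective
    (Finite.one_lt_card (α := IsLocalRing.ResidueField S))
  have h₁ : dimCenter S (SkewMonoidAlgebra T G) =
      dimCenter S (SkewMonoidAlgebra (Reduction S T) G) := by
    refine hq ?_
    simp only [card_residueField_pow_dimCenter]
    exact Nat.card_congr (Subring.centerCongr e₁).toEquiv
  refine ⟨h₁, h₁.symm.trans (hq ?_)⟩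
  simp only [card_residueField_pow_dimCenter, ← Finset.prod_pow_eq_pow_sum, ← card_quotient_addV]
  rw [Nat.card_congr (Subring.centerCongr e₀).toEquiv, card_center_quotient_jacobson hp hC]
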